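/- Let $n,m\ge 1$, let $0<\lambda_1\le\dots\le\lambda_n$ and $0<\mu_1<\dots<\mu_m$, and put $\Lambda^+=\mathrm{diag}(\lambda_1,\dots,\lambda_n)$, $\Lambda^-=\mathrm{diag}(\mu_1,\dots,\mu_m)$. Let $\Sigma^{++}\in\mathbb R^{n\times n}$, $\Sigma^{-+}\in\mathbb R^{m\times n}$, $R_1\in\mathbb R^{m\times n}$ be constant matrices, let $\Omega\in L^\infty((0,1);\mathbb R^{m\times m})$ be upper triangular, and let $D^+$ and $D^-$ be $L^\infty$ functions on the triangle $\{0\le\xi\le x\le1\}$ with values in $\mathbb R^{n\times n}$ and $\mathbb R^{m\times n}$. Consider, for $t\ge0$ and $x\in[0,1]$, the system $$\tilde\alpha_t(t,x)+\Lambda^+\tilde\alpha_x(t,x)=\Sigma^{++}\tilde\alpha(t,x)+\int_0^xD^+(x,\xi)\tilde\alpha(t,\xi)\,d\xi,$$ $$\tilde\beta_t(t,x)-\Lambda^-\tilde\beta_x(t,x)=\Sigma^{-+}\tilde\alpha(t,x)+\Omega(x)\tilde\beta(t,x)+\int_0^xD^-(x,\xi)\tilde\alpha(t,\xi)\,d\xi,$$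 with the boundary conditions $\tilde\alpha(t,0)=0$, $\tilde\beta(t,1)=R_1\tilde\alpha(t,1)$ and initial data $(\tilde\alpha^0,\tilde\beta^0)\in L^2([0,1])$. A solution is a pair $(\tilde\alpha,\tilde\beta)\in C([0,\infty);L^2(0,1)^n\times L^2(0,1)^m)$ with these initial data that satisfies, for every $T\ge 0$, the equations and boundary conditions on $[0,T]\times[0,1]$ in the weak sense, that is, tested against all pairs of $C^1$ functions $(\varphi,\psi)$ on $[0,T]\times[0,1]$ with $\psi(t,0)=0$ and $\Lambda^+\varphi(t,1)=R_1^{T}\Lambda^-\psi(t,1)$ for $t\in[0,T]$. Then every solution reaches the zero equilibrium in the finite time $$t_F=\frac1{\mu_1}+\frac1{\lambda_1},$$ that is, $\tilde\alpha(t,\cdot)=0$ and $\tilde\beta(t,\cdot)=0$ in $L^2(0,1)$ for all $t\ge t_F$. -/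

import Mathlib

open MeasureTheory Set

noncomputable section

/-- The real Hilbert space `L²(0,1)`. -/
abbrev L2unit : Type := Lp ℝ 2 (volume.restrict (Icc (0 : ℝ) 1))

/-- The triangle `0 ≤ ξ ≤ x ≤ 1`, as a set of pairs `(x, ξ)`. -/
def triangle : Set (ℝ × ℝ) := {p | 0 ≤ p.2 ∧ p.2 ≤ p.1 ∧ p.1 ≤ 1}

/-- The data of the observer-error target system
`α_t + Λ⁺ α_x = Σ⁺⁺ α + ∫₀ˣ D⁺(x,ξ) α(t,ξ) dξ`,
`β_t - Λ⁻ β_x = Σ⁻⁺ α + Ω(x) β + ∫₀ˣ D⁻(x,ξ) α(t,ξ) dξ`,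
`α(t,0) = 0`, `β(t,1) = R₁ α(t,1)`,
with `n` rightward and `m` leftward transport speeds. -/
structure ErrorTargetSystem (n m : ℕ) [NeZero n] [NeZero m] where
  /-- the diagonal of `Λ⁺` -/
  lam : Fin n → ℝ
  /-- the diagonal of `Λ⁻` -/
  mu : Fin m → ℝ
  SigmaPP : Matrix (Fin n) (Fin n) ℝ
  SigmaMP : Matrix (Fin m) (Fin n) ℝ
  R₁ : Matrix (Fin m) (Fin n) ℝ
  Omega : ℝ → Matrix (Fin m) (Fin m) ℝ
  DP : ℝ → ℝ → Matrix (Fin n) (Fin n) ℝ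
  DM : ℝ → ℝ → Matrix (Fin m) (Fin n) ℝ
  lam_pos : 0 < lam 0
  lam_mono : Monotone lam
  mu_pos : 0 < mu 0
  mu_strictMono : StrictMono mu
  Omega_bdd : ∀ i j, MemLp (fun x => Omega x i j) ⊤ (volume.restrict (Icc (0 : ℝ) 1))
  Omega_upper : ∀ᵐ x ∂(volume.restrict (Icc (0 : ℝ) 1)), ∀ i j, j < i → Omega x i j = 0
  DP_bdd : ∀ i j, MemLp (fun p : ℝ × ℝ => DP p.1 p.2 i j) ⊤ (volume.restrict triangle)
  DM_bdd : ∀ i j, MemLp (fun p : ℝ × ℝ => DM p.1 p.2 i j) ⊤ (volume.restrict triangle)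

namespace ErrorTargetSystem

variable {n m : ℕ} [NeZero n] [NeZero m]

/-- The time `t_F = 1/μ₁ + 1/λ₁` (indices start at `0` here). -/
def tF (S : ErrorTargetSystem n m) : ℝ := 1 / S.mu 0 + 1 / S.lam 0

/-- Right-hand side of the `α` equation at the point `x`. -/
def rhsA (S : ErrorTargetSystem n m) (a : Fin n → L2unit) (x : ℝ) (i : Fin n) : ℝ :=
  ∑ j, S.SigmaPP i j * a j x + ∫ ξ in (0 : ℝ)..x, ∑ j, S.DP x ξ i j * a j ξ

/-- Right-hand side of the `β` equation at the point `x`. -/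
def rhsB (S : ErrorTargetSystem n m) (a : Fin n → L2unit) (b : Fin m → L2unit) (x : ℝ)
    (i : Fin m) : ℝ :=
  ∑ j, S.SigmaMP i j * a j x + ∑ j, S.Omega x i j * b j x
    + ∫ ξ in (0 : ℝ)..x, ∑ j, S.DM x ξ i j * a j ξ

/-- `(φ, ψ)` is a pair of `C¹` test functions which satisfies, on the time interval `[0, T]`, the
boundary conditions `ψ(t,0) = 0` and `Λ⁺ φ(t,1) = R₁ᵀ Λ⁻ ψ(t,1)` adjoint to `α(t,0) = 0` and
`β(t,1) = R₁ α(t,1)`. -/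
structure IsTest (S : ErrorTargetSystem n m) (T : ℝ)
    (φ : ℝ → ℝ → Fin n → ℝ) (ψ : ℝ → ℝ → Fin m → ℝ) : Prop where
  contDiff_left : ContDiff ℝ 1 (fun p : ℝ × ℝ => φ p.1 p.2)
  contDiff_right : ContDiff ℝ 1 (fun p : ℝ × ℝ => ψ p.1 p.2)
  at_zero : ∀ t ∈ Icc 0 T, ψ t 0 = 0
  at_one : ∀ t ∈ Icc 0 T, ∀ j, S.lam j * φ t 1 j = ∑ i, S.R₁ i j * (S.mu i * ψ t 1 i)

/-- The `L²` pairing of the state `(a, b)` with a pair of functions on `[0, 1]`. -/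
def pairing (f : ℝ → Fin n → ℝ) (g : ℝ → Fin m → ℝ)
    (a : Fin n → L2unit) (b : Fin m → L2unit) : ℝ :=
  ∫ x in (0 : ℝ)..1, (∑ i, f x i * a i x + ∑ i, g x i * b i x)

/-- `(α, β)` is a (weak, `L²`) solution on `[0, ∞)` with initial data `(α₀, β₀)`: it is continuous
in time with values in `L²(0,1)`, and it satisfies the equations and the boundary conditions in the
weak form obtained by multiplying with test functions and integrating by parts over
`[0, T] × [0, 1]`. -/
structure IsSolution (S : ErrorTargetSystem n m) (α₀ : Fin n → L2unit) (β₀ : Fin m → L2unit)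
    (α : ℝ → Fin n → L2unit) (β : ℝ → Fin m → L2unit) : Prop where
  continuousOn_left : ContinuousOn α (Ici 0)
  continuousOn_right : ContinuousOn β (Ici 0)
  init_left : α 0 = α₀
  init_right : β 0 = β₀
  weak : ∀ T : ℝ, 0 ≤ T → ∀ φ ψ, S.IsTest T φ ψ →
    pairing (φ T) (ψ T) (α T) (β T) - pairing (φ 0) (ψ 0) α₀ β₀ =
      ∫ t in (0 : ℝ)..T, ∫ x in (0 : ℝ)..1,
        (∑ i, (deriv (fun s => φ s x i) t + S.lam i * deriv (fun y => φ t y i) x) * α t i x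
          + ∑ i, (deriv (fun s => ψ s x i) t - S.mu i * deriv (fun y => ψ t y i) x) * β t i x
          + ∑ i, φ t x i * S.rhsA (α t) x i
          + ∑ i, ψ t x i * S.rhsB (α t) (β t) x i)

end ErrorTargetSystem

end

/-! Information travels along characteristics. Below the line `x = λ₁ t`, every backward
`α`-characteristic meets the inflow boundary `x = 0`, where `α = 0`. The sources there see only the
same region, since the Volterra integral looks left. A Gronwall argument gives `α = 0` below that
line, hence on all of `(0,1)` from time `1/λ₁` (`left_eq_zero`). From then on `β` has no source but
`Ω β` and zero inflow at `x = 1`, and the mirrored argument empties it within a further `1/μ₁`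
(`right_eq_zero`).

For weak solutions, characteristics enter through test functions: a bump `f` transported backward in
time solves the homogeneous adjoint equation, which leaves a Duhamel identity with no data
(`left_duhamel`, `right_duhamel`). Duality with bumps turns it into an `L²` estimate, and
`ae_eq_zero_of_characteristics` closes both cases. -/

/-! ### `L²` norms over sections and duality with bumps. -/

/-- The `L²` norm of a function over a set. -/
noncomputable def normOn (g : ℝ → ℝ) (s : Set ℝ) : ℝ := √(∫ x in s, g x ^ 2)

lemma normOn_nonneg (g : ℝ → ℝ) (s : Set ℝ) : 0 ≤ normOn g s := Real.sqrt_nonneg _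

lemma norm_toLp_eq_normOn {g : ℝ → ℝ} {s : Set ℝ} (hg : MemLp g 2 (volume.restrict s)) :
    ‖hg.toLp g‖ = normOn g s := by
  have h : ‖hg.toLp g‖ ^ 2 = ∫ x in s, g x ^ 2 := by
    rw [← real_inner_self_eq_norm_sq, L2.inner_def]
    refine integral_congr_ae ?_
    filter_upwards [hg.coeFn_toLp] with x hx
    simp [hx, sq]
  rw [normOn, ← h, Real.sqrt_sq (norm_nonneg _)]

lemma inner_toLp_eq_setIntegral {f g : ℝ → ℝ} {s : Set ℝ} (hf : MemLp f 2 (volume.restrict s))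
    (hg : MemLp g 2 (volume.restrict s)) :
    inner ℝ (hf.toLp f) (hg.toLp g) = ∫ x in s, f x * g x := by
  rw [L2.inner_def]
  refine integral_congr_ae ?_
  filter_upwards [hf.coeFn_toLp, hg.coeFn_toLp] with x hx hy
  simp [hx, hy, mul_comm]

lemma abs_setIntegral_mul_le {f g : ℝ → ℝ} {s : Set ℝ} (hf : MemLp f 2 (volume.restrict s))
    (hg : MemLp g 2 (volume.restrict s)) :
    |∫ x in s, f x * g x| ≤ normOn f s * normOn g s := by
  rw [← inner_toLp_eq_setIntegral hf hg, ← norm_toLp_eq_normOn hf, ← norm_toLp_eq_normOn hg]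
  exact abs_real_inner_le_norm _ _

/-- `C¹` functions with compact support in the open set `U`. -/
structure IsBump (U : Set ℝ) (f : ℝ → ℝ) : Prop where
  contDiff : ContDiff ℝ 1 f
  hasCompactSupport : HasCompactSupport f
  tsupport_subset : tsupport f ⊆ U

lemma IsBump.memLp {U : Set ℝ} {f : ℝ → ℝ} (hf : IsBump U f) (s : Set ℝ) :
    MemLp f 2 (volume.restrict s) :=
  (hf.contDiff.continuous.memLp_of_hasCompactSupport hf.hasCompactSupport).restrict s

lemma IsBump.eq_zero {U : Set ℝ} {f : ℝ → ℝ} (hf : IsBump U f) {x : ℝ} (hx : x ∉ U) : f x = 0 :=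
  image_eq_zero_of_notMem_tsupport fun h => hx (hf.tsupport_subset h)

lemma IsBump.hasDerivAt_zero {U : Set ℝ} {f : ℝ → ℝ} (hf : IsBump U f) {x : ℝ} (hx : x ∉ U) :
    HasDerivAt f 0 x := by
  have h : deriv f x = 0 :=
    image_eq_zero_of_notMem_tsupport fun h => hx (hf.tsupport_subset (tsupport_deriv_subset h))
  exact h ▸ (hf.contDiff.differentiable (by norm_num) x).hasDerivAt

/-- The classes of `C¹` functions with compact support in `U`, as a subspace of `L²(U)`. -/
def bumpSubmodule (U : Set ℝ) : Submodule ℝ (Lp ℝ 2 (volume.restrict U)) where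
  carrier := {v | ∃ f, ∃ hf : IsBump U f, (hf.memLp U).toLp f = v}
  zero_mem' := by
    have h : IsBump U 0 :=
      ⟨contDiff_const, HasCompactSupport.zero, by simp [tsupport]⟩
    exact ⟨0, h, MemLp.toLp_zero _⟩
  add_mem' := by
    rintro _ _ ⟨f, hf, rfl⟩ ⟨g, hg, rfl⟩
    exact ⟨f + g, ⟨hf.contDiff.add hg.contDiff, hf.hasCompactSupport.add hg.hasCompactSupport,
      (tsupport_add f g).trans (union_subset hf.tsupport_subset hg.tsupport_subset)⟩,
      MemLp.toLp_add _ _⟩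
  smul_mem' := by
    rintro c _ ⟨f, hf, rfl⟩
    exact ⟨c • f, ⟨contDiff_const.smul hf.contDiff, hf.hasCompactSupport.smul_left,
      (tsupport_smul_subset_right (fun _ => c) f).trans hf.tsupport_subset⟩,
      MemLp.toLp_const_smul _ _⟩

/-- By the fundamental lemma of the calculus of variations, the orthogonal complement is trivial. -/
lemma dense_bumpSubmodule {U : Set ℝ} (hU : IsOpen U) :
    Dense (bumpSubmodule U : Set (Lp ℝ 2 (volume.restrict U))) := by
  rw [Submodule.dense_iff_topologicalClosure_eq_top, Submodule.topologicalClosure_eq_top_iff,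
    Submodule.eq_bot_iff]
  intro w hw
  have h := hU.ae_eq_zero_of_integral_contDiff_smul_eq_zero (μ := volume) (f := w)
    (locallyIntegrableOn_of_locallyIntegrable_restrict
      ((Lp.memLp w).locallyIntegrable (by norm_num))) fun f hf hfc hfU => by
    have hb : IsBump U f := ⟨hf.of_le (by exact_mod_cast le_top), hfc, hfU⟩
    have h0 := (Submodule.mem_orthogonal _ _).1 hw _ ⟨f, hb, rfl⟩
    rw [← Lp.toLp_coeFn w (Lp.memLp w), inner_toLp_eq_setIntegral] at h0
    rw [← setIntegral_eq_integral_of_forall_compl_eq_zero (s := U) fun x hx => by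
      simp [hb.eq_zero hx]]
    simpa using h0
  rw [Lp.eq_zero_iff_ae_eq_zero]
  exact (ae_restrict_iff' hU.measurableSet).2 h

/-- A bound for the pairings with bump functions bounds the `L²` norm. -/
lemma normOn_le_of_forall_isBump {U : Set ℝ} (hU : IsOpen U) {g : ℝ → ℝ} {B : ℝ}
    (hg : MemLp g 2 (volume.restrict U))
    (h : ∀ f, IsBump U f → |∫ x in U, f x * g x| ≤ B * normOn f U) (hB : 0 ≤ B) :
    normOn g U ≤ B := by
  have hall : ∀ v : Lp ℝ 2 (volume.restrict U), |inner ℝ v (hg.toLp g)| ≤ B * ‖v‖ := by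
    intro v
    have hc : IsClosed {v : Lp ℝ 2 (volume.restrict U) | |inner ℝ v (hg.toLp g)| ≤ B * ‖v‖} :=
      isClosed_le (by fun_prop) (by fun_prop)
    refine hc.closure_subset_iff.2 ?_ (dense_bumpSubmodule hU v)
    rintro _ ⟨f, hf, rfl⟩
    simpa only [mem_ofPred_eq, inner_toLp_eq_setIntegral, norm_toLp_eq_normOn] using h f hf
  -- Taking `g` itself as the test vector gives `‖g‖² ≤ B ‖g‖`.
  have h1 := hall (hg.toLp g)
  rw [real_inner_self_eq_norm_sq, abs_of_nonneg (sq_nonneg _), norm_toLp_eq_normOn] at h1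
  by_contra! h2
  nlinarith [normOn_nonneg g U]

/-! ### Gronwall inequality and pairing estimates. -/

/-- A Gronwall inequality tested against continuous majorants, so that no measurability of the
functions involved is needed. -/
lemma nonpos_of_forall_le_integral {ι : Type*} {p : ι → ℝ → ℝ} {K C T₁ : ℝ} (hT₁ : 0 ≤ T₁)
    (hK : ∀ i, ∀ t ∈ Icc 0 T₁, p i t ≤ K)
    (h : ∀ T ∈ Icc 0 T₁, ∀ B : ℝ → ℝ, Continuous B → (∀ t ∈ Icc 0 T, ∀ j, p j t ≤ B t) →
      ∀ i, p i T ≤ C * ∫ t in (0 : ℝ)..T, B t) (i : ι) : p i T₁ ≤ 0 := by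
  -- Picard iteration: each bound is a continuous majorant to which `h` applies again.
  have key : ∀ k : ℕ, ∀ T ∈ Icc 0 T₁, ∀ i, p i T ≤ K * ((C * T) ^ k / k.factorial) := by
    intro k
    induction k with
    | zero => intro T hT i; simpa using hK i T hT
    | succ k ih =>
      intro T hT i
      refine (h T hT (fun t => K * ((C * t) ^ k / k.factorial)) (by fun_prop)
        (fun t ht j => ih t ⟨ht.1, ht.2.trans hT.2⟩ j) i).trans_eq ?_
      simp only [mul_pow]
      rw [intervalIntegral.integral_const_mul, intervalIntegral.integral_div,
        intervalIntegral.integral_const_mul, integral_pow, Nat.factorial_succ]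
      push_cast
      field_simp
      ring
  have hlim := (FloorSemiring.tendsto_pow_div_factorial_atTop (C * T₁)).const_mul K
  rw [mul_zero] at hlim
  exact ge_of_tendsto' hlim fun k => key k T₁ ⟨hT₁, le_rfl⟩ i

lemma normOn_abs (g : ℝ → ℝ) (s : Set ℝ) : normOn (fun x => |g x|) s = normOn g s := by
  simp [normOn]

lemma normOn_one_le {s : Set ℝ} (hs : s ⊆ Icc 0 1) : normOn (fun _ => 1) s ≤ 1 := by
  rw [normOn, Real.sqrt_le_one]
  have h : volume.real s ≤ 1 := by
    refine (measureReal_mono hs isCompact_Icc.measure_lt_top.ne).trans_eq ?_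
    simp
  simpa using h

lemma memLp_of_subset (a : L2unit) {s : Set ℝ} (hs : s ⊆ Icc 0 1) :
    MemLp a 2 (volume.restrict s) :=
  (Lp.memLp a).mono_measure (Measure.restrict_mono hs le_rfl)

lemma normOn_le_norm (a : L2unit) {s : Set ℝ} (hs : s ⊆ Icc 0 1) : normOn a s ≤ ‖a‖ := by
  have h := norm_toLp_eq_normOn (Lp.memLp a)
  rw [Lp.toLp_coeFn] at h
  rw [h]
  refine Real.sqrt_le_sqrt (setIntegral_mono_set (Lp.memLp a).integrable_sq ?_ ?_)
  · exact Filter.Eventually.of_forall fun x => sq_nonneg _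
  · exact hs.eventuallyLE

/-- Cauchy–Schwarz twice, the second time against `1`, whose norm on `s` is at most `1`; hence the
factor 2. The summand `|a x|` models local terms, `normOn a s` the Volterra terms. -/
lemma setIntegral_abs_mul_add_normOn_le {F : ℝ → ℝ} (a : L2unit) {s : Set ℝ} (hs : s ⊆ Icc 0 1)
    (hF : MemLp F 2 (volume.restrict s)) :
    Integrable (fun x => |F x| * (|a x| + normOn a s)) (volume.restrict s) ∧
    ∫ x in s, |F x| * (|a x| + normOn a s) ≤ 2 * (normOn F s * normOn a s) := by
  have : IsFiniteMeasure (volume.restrict s) :=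
    ⟨by simpa using (measure_mono hs).trans_lt (by simp)⟩
  have ha := (memLp_of_subset a hs).norm
  have h1 : MemLp (fun _ : ℝ => (1 : ℝ)) 2 (volume.restrict s) := memLp_const 1
  have i1 : Integrable (fun x => |F x| * |a x|) (volume.restrict s) :=
    hF.norm.integrable_mul ha
  have i2 : Integrable (fun x => |F x| * 1) (volume.restrict s) := hF.norm.integrable_mul h1
  have e : (fun x => |F x| * (|a x| + normOn a s)) =
      fun x => |F x| * |a x| + normOn a s * (|F x| * 1) := by ext; ring
  rw [e]
  refine ⟨i1.add (i2.const_mul _), ?_⟩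
  rw [integral_add i1 (i2.const_mul _), integral_const_mul]
  have b1 := (le_abs_self _).trans (abs_setIntegral_mul_le hF.norm ha)
  have b2 := (le_abs_self _).trans (abs_setIntegral_mul_le hF.norm h1)
  simp only [Real.norm_eq_abs, normOn_abs] at b1 b2
  have b3 := normOn_one_le hs
  have := normOn_nonneg F s
  have := normOn_nonneg a s
  nlinarith [mul_le_mul_of_nonneg_left b3 (normOn_nonneg F s)]

/-- `H` need not be measurable: only the dominating function has to be integrable. -/
lemma abs_setIntegral_mul_le_of_ae_le {n : ℕ} {F H : ℝ → ℝ} (a : Fin n → L2unit) {s : Set ℝ}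
    {M : ℝ} (hM : 0 ≤ M) (hs : s ⊆ Icc 0 1) (hF : MemLp F 2 (volume.restrict s))
    (hH : ∀ᵐ x ∂(volume.restrict s), |H x| ≤ M * ∑ j, (|a j x| + normOn (a j) s)) :
    |∫ x in s, F x * H x| ≤ normOn F s * (2 * M * ∑ j, normOn (a j) s) := by
  have hj := fun j => setIntegral_abs_mul_add_normOn_le (a j) hs hF
  have hb : |∫ x in s, F x * H x| ≤
      ∫ x in s, M * ∑ j, |F x| * (|a j x| + normOn (a j) s) := by
    rw [← Real.norm_eq_abs]
    refine norm_integral_le_of_norm_le ((integrable_finsetSum _ fun j _ => (hj j).1).const_mul M) ?_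
    filter_upwards [hH] with x hx
    rw [Real.norm_eq_abs, abs_mul, ← Finset.mul_sum, mul_left_comm]
    exact mul_le_mul_of_nonneg_left hx (abs_nonneg _)
  refine hb.trans ?_
  rw [integral_const_mul, integral_finsetSum _ fun j _ => (hj j).1]
  calc M * ∑ j, ∫ x in s, |F x| * (|a j x| + normOn (a j) s)
      ≤ M * ∑ j, 2 * (normOn F s * normOn (a j) s) :=
        mul_le_mul_of_nonneg_left (Finset.sum_le_sum fun j _ => (hj j).2) hM
    _ = _ := by rw [← Finset.mul_sum, ← Finset.mul_sum]; ring

lemma IsBump.normOn_comp_add_le {U : Set ℝ} {f : ℝ → ℝ} (hf : IsBump U f) (d : ℝ) (s : Set ℝ) :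
    normOn (fun x => f (x + d)) s ≤ normOn f U := by
  refine Real.sqrt_le_sqrt ?_
  have hi : Integrable fun x => f x ^ 2 := by
    simpa using (hf.memLp univ).integrable_sq
  calc ∫ x in s, f (x + d) ^ 2 ≤ ∫ x, f (x + d) ^ 2 :=
        setIntegral_le_integral (hi.comp_add_right d) (Filter.Eventually.of_forall fun x => sq_nonneg _)
    _ = ∫ x, f x ^ 2 := integral_add_right_eq_self (fun x => f x ^ 2) d
    _ = _ := (setIntegral_eq_integral_of_forall_compl_eq_zero fun x hx => by
        simp [hf.eq_zero hx]).symm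

lemma intervalIntegral_eq_setIntegral_of_eq_zero {F : ℝ → ℝ} {s : Set ℝ} (hs : s ⊆ Ioo 0 1)
    (h : ∀ x ∈ Ioo (0 : ℝ) 1, x ∉ s → F x = 0) : ∫ x in (0 : ℝ)..1, F x = ∫ x in s, F x := by
  rw [intervalIntegral.integral_of_le zero_le_one, integral_Ioc_eq_integral_Ioo]
  exact (setIntegral_eq_of_subset_of_forall_sdiff_eq_zero measurableSet_Ioo hs
    fun x hx => h x hx.1 hx.2)

/-! ### Uniqueness along characteristics. -/

/-- Uniqueness for transport along characteristics: if the lower-order terms are bounded, over the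
sections `(l t, r t)`, by the state there, and the backward characteristics stay in these sections,
then the state vanishes on them. -/
theorem ae_eq_zero_of_characteristics {n : ℕ} {u : ℝ → Fin n → L2unit}
    (hu : ContinuousOn u (Ici 0)) {c : Fin n → ℝ} {l r : ℝ → ℝ} (hl : ∀ t, 0 ≤ l t)
    (hr : ∀ t, r t ≤ 1) {G : Fin n → ℝ → ℝ → ℝ} {M : ℝ} (hM : 0 ≤ M)
    (hG : ∀ t, 0 ≤ t → ∀ i, ∀ᵐ x ∂(volume.restrict (Ioo (l t) (r t))),
      |G i t x| ≤ M * ∑ j, (|u t j x| + normOn (u t j) (Ioo (l t) (r t))))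
    (hchar : ∀ i t T x, 0 ≤ t → t ≤ T → x ∈ Ioo (0 : ℝ) 1 →
      x + c i * (T - t) ∈ Ioo (l T) (r T) → x ∈ Ioo (l t) (r t))
    (hweak : ∀ T, 0 ≤ T → ∀ i f, IsBump (Ioo (l T) (r T)) f →
      ∫ x in (0 : ℝ)..1, f x * u T i x =
        ∫ t in (0 : ℝ)..T, ∫ x in (0 : ℝ)..1, f (x + c i * (T - t)) * G i t x)
    {T : ℝ} (hT : 0 ≤ T) (i : Fin n) :
    ∀ᵐ x ∂(volume.restrict (Ioo (l T) (r T))), u T i x = 0 := by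
  have hsub : ∀ t, Ioo (l t) (r t) ⊆ Ioo 0 1 := fun t => Ioo_subset_Ioo (hl t) (hr t)
  have hsub' := fun t => (hsub t).trans Ioo_subset_Icc_self
  obtain ⟨K, hK⟩ := isCompact_Icc.exists_bound_of_continuousOn
    (hu.mono (Icc_subset_Ici_self : Icc 0 T ⊆ Ici 0))
  have hzero : normOn (u T i) (Ioo (l T) (r T)) ≤ 0 := by
    -- In `C`, the factor `2 * M` comes from pairing with `G`, and `n` from summing the components,
    -- each at most `B t`.
    refine nonpos_of_forall_le_integral (p := fun j t => normOn (u t j) (Ioo (l t) (r t)))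
      (K := K) (C := 2 * M * n) hT (fun j t ht => (normOn_le_norm _ (hsub' t)).trans
        ((norm_le_pi_norm (u t) j).trans (hK t ht))) ?_ i
    intro T' hT' B hB hpB j
    have hB0 : ∀ t ∈ Icc 0 T', 0 ≤ B t := fun t ht => (normOn_nonneg _ _).trans (hpB t ht j)
    refine normOn_le_of_forall_isBump isOpen_Ioo (memLp_of_subset _ (hsub' T')) ?_
      (mul_nonneg (by positivity) (intervalIntegral.integral_nonneg hT'.1 hB0))
    intro f hf
    rw [← intervalIntegral_eq_setIntegral_of_eq_zero (hsub T')
      (fun x _ hx => by rw [hf.eq_zero hx, zero_mul]), hweak T' hT'.1 j f hf]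
    have hbound : ∀ t ∈ Icc 0 T', |∫ x in (0 : ℝ)..1, f (x + c j * (T' - t)) * G j t x| ≤
        normOn f (Ioo (l T') (r T')) * (2 * M * n) * B t := by
      intro t ht
      -- By `hchar`, the transported bump lives in the section at time `t`, the only place where `G`
      -- is controlled.
      rw [intervalIntegral_eq_setIntegral_of_eq_zero (hsub t) fun x hx hx' => by
        rw [hf.eq_zero fun h => hx' (hchar j t T' x ht.1 ht.2 hx h), zero_mul]]
      have hFm : MemLp (fun x => f (x + c j * (T' - t))) 2
          (volume.restrict (Ioo (l t) (r t))) := by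
        refine MemLp.restrict _ (Continuous.memLp_of_hasCompactSupport
          (hf.contDiff.continuous.comp (by fun_prop)) ?_)
        exact hf.hasCompactSupport.comp_homeomorph (Homeomorph.addRight _)
      refine (abs_setIntegral_mul_le_of_ae_le (u t) hM (hsub' t) hFm (hG t ht.1 j)).trans ?_
      have hsum : ∑ k, normOn (u t k) (Ioo (l t) (r t)) ≤ n * B t := by
        simpa using Finset.sum_le_sum fun k (_ : k ∈ Finset.univ) => hpB t ht k
      calc _ ≤ normOn f (Ioo (l T') (r T')) * (2 * M * (n * B t)) :=
            mul_le_mul (hf.normOn_comp_add_le _ _) (by gcongr)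
              (mul_nonneg (by positivity) (Finset.sum_nonneg fun k _ => normOn_nonneg _ _))
              (normOn_nonneg _ _)
        _ = _ := by ring
    rw [← Real.norm_eq_abs]
    refine (intervalIntegral.norm_integral_le_of_norm_le hT'.1 (Filter.Eventually.of_forall
      fun t ht => hbound t (Ioc_subset_Icc_self ht))
      ((hB.const_mul _).intervalIntegrable _ _)).trans_eq ?_
    rw [intervalIntegral.integral_const_mul]
    ring
  have h0 := le_antisymm hzero (normOn_nonneg _ _)
  rw [← norm_toLp_eq_normOn (memLp_of_subset _ (hsub' T)), norm_eq_zero] at h0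
  have h1 := (memLp_of_subset (u T i) (hsub' T)).coeFn_toLp
  rw [h0] at h1
  filter_upwards [h1, Lp.coeFn_zero ℝ 2 (volume.restrict (Ioo (l T) (r T)))] with x hx hx'
  rw [← hx, hx']; rfl

/-! ### Bounds for the lower-order terms. -/

lemma exists_ae_forall_abs_le {ι X : Type*} [Fintype ι] [MeasurableSpace X] {μ : Measure X}
    {f : ι → X → ℝ} (hf : ∀ i, MemLp (f i) ⊤ μ) : ∃ C, 0 ≤ C ∧ ∀ᵐ x ∂μ, ∀ i, |f i x| ≤ C := by
  refine ⟨∑ i, (eLpNormEssSup (f i) μ).toReal, Finset.sum_nonneg fun i _ => ENNReal.toReal_nonneg,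
    ae_all_iff.2 fun i => ?_⟩
  filter_upwards [ae_le_eLpNormEssSup (f := f i) (μ := μ)] with x hx
  have hfin : eLpNormEssSup (f i) μ ≠ ⊤ := by
    simpa using (hf i).2.ne
  have h1 : |f i x| ≤ (eLpNormEssSup (f i) μ).toReal := by
    simpa using ENNReal.toReal_mono hfin hx
  exact h1.trans (Finset.single_le_sum (f := fun i => (eLpNormEssSup (f i) μ).toReal)
    (fun i _ => ENNReal.toReal_nonneg) (Finset.mem_univ i))

lemma measurableSet_triangle : MeasurableSet triangle := by
  refine IsClosed.measurableSet ?_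
  exact (isClosed_le continuous_const continuous_snd).inter
    ((isClosed_le continuous_snd continuous_fst).inter (isClosed_le continuous_fst continuous_const))

lemma ae_of_ae_restrict_triangle {p : ℝ × ℝ → Prop} (h : ∀ᵐ z ∂(volume.restrict triangle), p z) :
    ∀ᵐ x : ℝ, ∀ᵐ ξ : ℝ, (x, ξ) ∈ triangle → p (x, ξ) := by
  rw [ae_restrict_iff' measurableSet_triangle, Measure.volume_eq_prod] at h
  exact Measure.ae_ae_of_ae_prod h

lemma setIntegral_abs_le_normOn (a : L2unit) {s : Set ℝ} (hs : s ⊆ Icc 0 1) :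
    ∫ x in s, |a x| ≤ normOn a s := by
  have : IsFiniteMeasure (volume.restrict s) :=
    ⟨by simpa using (measure_mono hs).trans_lt (by simp)⟩
  have h := (le_abs_self _).trans (abs_setIntegral_mul_le (memLp_of_subset a hs).norm
    (memLp_const (1 : ℝ) : MemLp (fun _ => (1 : ℝ)) 2 (volume.restrict s)))
  simp only [Real.norm_eq_abs, normOn_abs, mul_one] at h
  nlinarith [normOn_one_le hs, normOn_nonneg a s]

lemma integrableOn_Ioo (a : L2unit) {r : ℝ} (hr : r ≤ 1) : IntegrableOn a (Ioo 0 r) :=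
  (memLp_of_subset a ((Ioo_subset_Ioo le_rfl hr).trans Ioo_subset_Icc_self)).integrable
    (by norm_num)

/-- Since `(0, x) ⊆ (0, r)`, the integral sees only the state in the section, so sections anchored
at `0` are closed under the coupling. -/
lemma abs_volterra_le {n : ℕ} {k : ℝ → Fin n → ℝ} {C x r : ℝ} (hC : 0 ≤ C)
    (hx : x ∈ Ioo 0 r) (hr : r ≤ 1) (hk : ∀ᵐ ξ, ξ ∈ Icc 0 x → ∀ j, |k ξ j| ≤ C)
    (a : Fin n → L2unit) :
    |∫ ξ in (0 : ℝ)..x, ∑ j, k ξ j * a j ξ| ≤ C * ∑ j, normOn (a j) (Ioo 0 r) := by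
  have hsub : Ioc 0 x ⊆ Ioo 0 r := Ioc_subset_Ioo_right hx.2
  have hint : ∀ j, IntegrableOn (fun ξ => |a j ξ|) (Ioo 0 r) := fun j =>
    (integrableOn_Ioo (a j) hr).abs
  have hii : ∀ j, IntervalIntegrable (fun ξ => |a j ξ|) volume 0 x := fun j =>
    (intervalIntegrable_iff_integrableOn_Ioc_of_le hx.1.le).2 ((hint j).mono_set hsub)
  have hb : |∫ ξ in (0 : ℝ)..x, ∑ j, k ξ j * a j ξ| ≤ ∫ ξ in (0 : ℝ)..x, C * ∑ j, |a j ξ| := by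
    rw [← Real.norm_eq_abs]
    refine intervalIntegral.norm_integral_le_of_norm_le hx.1.le ?_ ?_
    · filter_upwards [hk] with ξ hξ hmem
      rw [Finset.mul_sum]
      refine (norm_sum_le _ _).trans (Finset.sum_le_sum fun j _ => ?_)
      rw [Real.norm_eq_abs, abs_mul]
      exact mul_le_mul_of_nonneg_right (hξ (Ioc_subset_Icc_self hmem) j) (abs_nonneg _)
    · have hs := (IntervalIntegrable.sum Finset.univ fun j _ => hii j).const_mul C
      simpa only [Finset.sum_apply] using hs
  refine hb.trans ?_
  rw [intervalIntegral.integral_const_mul, intervalIntegral.integral_finsetSum fun j _ => hii j]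
  refine mul_le_mul_of_nonneg_left (Finset.sum_le_sum fun j _ => ?_) hC
  rw [intervalIntegral.integral_of_le hx.1.le]
  exact (setIntegral_mono_set (hint j) (Filter.Eventually.of_forall fun x => abs_nonneg _)
    hsub.eventuallyLE).trans (setIntegral_abs_le_normOn _
      ((Ioo_subset_Ioo le_rfl hr).trans Ioo_subset_Icc_self))

lemma abs_sum_mul_le {n : ℕ} {k v : Fin n → ℝ} {C : ℝ} (hk : ∀ j, |k j| ≤ C) :
    |∑ j, k j * v j| ≤ C * ∑ j, |v j| := by
  rw [Finset.mul_sum]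
  refine (Finset.abs_sum_le_sum_abs _ _).trans (Finset.sum_le_sum fun j _ => ?_)
  rw [abs_mul]
  exact mul_le_mul_of_nonneg_right (hk j) (abs_nonneg _)

/-- The profile is constant along lines of slope `c`. -/
lemma deriv_add_mul_deriv_comp {f : ℝ → ℝ} (hf : ContDiff ℝ 1 f) (c T t x : ℝ) :
    deriv (fun s => f (x + c * (T - s))) t + c * deriv (fun y => f (y + c * (T - t))) x = 0 := by
  have hd := (hf.differentiable (by norm_num) (x + c * (T - t))).hasDerivAt
  have h1 : HasDerivAt (fun s => x + c * (T - s)) (c * -1) t :=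
    (((hasDerivAt_id t).const_sub T).const_mul c).const_add x
  have h2 : HasDerivAt (fun y => y + c * (T - t)) 1 x := (hasDerivAt_id x).add_const _
  have e1 : deriv (fun s => f (x + c * (T - s))) t = _ := (hd.comp t h1).deriv
  have e2 : deriv (fun y => f (y + c * (T - t))) x = _ := (HasDerivAt.comp x hd h2).deriv
  rw [e1, e2]
  ring

lemma Lp_eq_zero_of_ae_Ioo {a : L2unit} (h : ∀ᵐ x ∂(volume.restrict (Ioo (0 : ℝ) 1)), a x = 0) :
    a = 0 := by
  rw [Measure.restrict_congr_set Ioo_ae_eq_Icc] at h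
  exact Lp.eq_zero_iff_ae_eq_zero.2 h

lemma ae_coe_zero : ∀ᵐ x, x ∈ Icc (0 : ℝ) 1 → (0 : L2unit) x = 0 := by
  rw [← ae_restrict_iff' measurableSet_Icc]
  exact Lp.coeFn_zero ℝ 2 _

lemma volterra_zero {n : ℕ} {k : ℝ → Fin n → ℝ} {x : ℝ} (hx : x ∈ Icc (0 : ℝ) 1) :
    ∫ ξ in (0 : ℝ)..x, ∑ j, k ξ j * (0 : L2unit) ξ = 0 := by
  refine intervalIntegral.integral_zero_ae ?_
  filter_upwards [ae_coe_zero] with ξ hξ hmem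
  rw [uIoc_of_le hx.1] at hmem
  exact Finset.sum_eq_zero fun j _ => by rw [hξ ⟨hmem.1.le, hmem.2.trans hx.2⟩, mul_zero]

namespace ErrorTargetSystem

variable {n m : ℕ} [NeZero n] [NeZero m]

lemma lam_zero_le (S : ErrorTargetSystem n m) (i : Fin n) : S.lam 0 ≤ S.lam i :=
  S.lam_mono (Fin.zero_le i)

lemma mu_zero_le (S : ErrorTargetSystem n m) (i : Fin m) : S.mu 0 ≤ S.mu i :=
  S.mu_strictMono.monotone (Fin.zero_le i)

lemma exists_abs_rhsA_le (S : ErrorTargetSystem n m) : ∃ M, 0 ≤ M ∧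
    ∀ (a : Fin n → L2unit) (r : ℝ), r ≤ 1 → ∀ i, ∀ᵐ x ∂(volume.restrict (Ioo 0 r)),
      |S.rhsA a x i| ≤ M * ∑ j, (|a j x| + normOn (a j) (Ioo 0 r)) := by
  obtain ⟨C, hC, hD⟩ := exists_ae_forall_abs_le
    (f := fun (q : Fin n × Fin n) (p : ℝ × ℝ) => S.DP p.1 p.2 q.1 q.2)
    fun q => S.DP_bdd q.1 q.2
  have hσ : ∀ i j, |S.SigmaPP i j| ≤ ∑ i, ∑ j, |S.SigmaPP i j| := fun i j =>
    (Finset.single_le_sum (f := fun j => |S.SigmaPP i j|) (fun _ _ => abs_nonneg _)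
      (Finset.mem_univ j)).trans (Finset.single_le_sum (f := fun i => ∑ j, |S.SigmaPP i j|)
        (fun _ _ => Finset.sum_nonneg fun _ _ => abs_nonneg _) (Finset.mem_univ i))
  set σ := ∑ i, ∑ j, |S.SigmaPP i j|
  have hσ0 : 0 ≤ σ := Finset.sum_nonneg fun _ _ => Finset.sum_nonneg fun _ _ => abs_nonneg _
  refine ⟨σ + C, add_nonneg hσ0 hC, fun a r hr i => ?_⟩
  rw [ae_restrict_iff' measurableSet_Ioo]
  filter_upwards [ae_of_ae_restrict_triangle hD] with x hx hxr
  have h1 := abs_sum_mul_le (v := fun j => a j x) (hσ i)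
  have h2 := abs_volterra_le (k := fun ξ j => S.DP x ξ i j) hC hxr hr (by
    filter_upwards [hx] with ξ hξ hmem j
    exact hξ ⟨hmem.1, hmem.2, hxr.2.le.trans hr⟩ (i, j)) a
  refine (abs_add_le _ _).trans ((add_le_add h1 h2).trans ?_)
  have p1 : 0 ≤ ∑ j, |a j x| := Finset.sum_nonneg fun _ _ => abs_nonneg _
  have p2 : 0 ≤ ∑ j, normOn (a j) (Ioo 0 r) := Finset.sum_nonneg fun _ _ => normOn_nonneg _ _
  rw [Finset.sum_add_distrib]
  nlinarith [mul_nonneg hσ0 p2, mul_nonneg hC p1]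

lemma exists_abs_Omega_le (S : ErrorTargetSystem n m) : ∃ M, 0 ≤ M ∧
    ∀ (b : Fin m → L2unit) (l : ℝ), 0 ≤ l → ∀ i, ∀ᵐ x ∂(volume.restrict (Ioo l 1)),
      |∑ j, S.Omega x i j * b j x| ≤ M * ∑ j, (|b j x| + normOn (b j) (Ioo l 1)) := by
  obtain ⟨C, hC, hΩ⟩ := exists_ae_forall_abs_le
    (f := fun (q : Fin m × Fin m) (x : ℝ) => S.Omega x q.1 q.2) fun q => S.Omega_bdd q.1 q.2
  refine ⟨C, hC, fun b l hl i => ?_⟩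
  filter_upwards [ae_restrict_of_ae_restrict_of_subset
    ((Ioo_subset_Ioo hl le_rfl).trans Ioo_subset_Icc_self) hΩ] with x hx
  refine (abs_sum_mul_le fun j => hx (i, j)).trans (mul_le_mul_of_nonneg_left ?_ hC)
  exact Finset.sum_le_sum fun j _ => le_add_of_nonneg_right (normOn_nonneg _ _)

lemma rhsA_zero (S : ErrorTargetSystem n m) :
    ∀ᵐ x, x ∈ Icc (0 : ℝ) 1 → ∀ i, S.rhsA 0 x i = 0 := by
  filter_upwards [ae_coe_zero] with x hx hmem i
  simp only [rhsA, Pi.zero_apply, hx hmem, volterra_zero hmem]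
  simp

lemma rhsB_zero_left (S : ErrorTargetSystem n m) (b : Fin m → L2unit) :
    ∀ᵐ x, x ∈ Icc (0 : ℝ) 1 → ∀ i, S.rhsB 0 b x i = ∑ j, S.Omega x i j * b j x := by
  filter_upwards [ae_coe_zero] with x hx hmem i
  simp only [rhsB, Pi.zero_apply, hx hmem, volterra_zero hmem]
  simp

/-! ### Duhamel identities and extinction of `α`, then `β`. -/

variable {S : ErrorTargetSystem n m} {α₀ : Fin n → L2unit} {β₀ : Fin m → L2unit}
  {α : ℝ → Fin n → L2unit} {β : ℝ → Fin m → L2unit}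

/-- The test pair is the transported bump in component `i`, with `ψ = 0`. The support of `f` removes
both the trace at `x = 1` and the initial data. -/
lemma IsSolution.left_duhamel (h : S.IsSolution α₀ β₀ α β) {T : ℝ} (hT : 0 ≤ T) (i : Fin n)
    {f : ℝ → ℝ} (hf : IsBump (Ioo 0 (min 1 (S.lam 0 * T))) f) :
    ∫ x in (0 : ℝ)..1, f x * α T i x =
      ∫ t in (0 : ℝ)..T, ∫ x in (0 : ℝ)..1, f (x + S.lam i * (T - t)) * S.rhsA (α t) x i := by
  have hlam := S.lam_zero_le i
  have hpos := S.lam_pos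
  have htest : S.IsTest T (fun t x j => if j = i then f (x + S.lam i * (T - t)) else 0)
      (fun _ _ _ => 0) := by
    refine ⟨contDiff_pi.2 fun j => ?_, contDiff_const, fun _ _ => rfl, fun t ht j => ?_⟩
    · split_ifs
      · exact hf.contDiff.comp (by fun_prop)
      · exact contDiff_const
    · have : f (1 + S.lam i * (T - t)) = 0 := hf.eq_zero fun hm => by
        have := hm.2.trans_le (min_le_left _ _)
        nlinarith [ht.2]
      simp [this]
  have hw := h.weak T hT _ _ htest
  have hinit : ∀ x ∈ Ioo (0 : ℝ) 1, f (x + S.lam i * T) = 0 := fun x hx => hf.eq_zero fun hm => by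
    have := hm.2.trans_le (min_le_right _ _)
    nlinarith [hx.1]
  have h0 : ∫ x in (0 : ℝ)..1, f (x + S.lam i * T) * α₀ i x = 0 := by
    rw [intervalIntegral_eq_setIntegral_of_eq_zero (s := ∅) (empty_subset _)
      fun x hx _ => by rw [hinit x hx, zero_mul]]
    simp
  have hd : ∀ t x j, deriv (fun s => if j = i then f (x + S.lam i * (T - s)) else 0) t +
      S.lam j * deriv (fun y => if j = i then f (y + S.lam i * (T - t)) else 0) x = 0 := by
    intro t x j
    by_cases hj : j = i
    · subst hj
      simpa using deriv_add_mul_deriv_comp hf.contDiff _ T t x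
    · simp [hj]
  simp only [hd] at hw
  simpa [pairing, h0] using hw

/-- The state `α` vanishes left of the slowest characteristic issued from the origin. -/
lemma IsSolution.left_eq_zero (h : S.IsSolution α₀ β₀ α β) {t : ℝ} (ht : 1 / S.lam 0 ≤ t) :
    α t = 0 := by
  obtain ⟨M, hM, hA⟩ := S.exists_abs_rhsA_le
  have hpos := S.lam_pos
  have ht0 : 0 ≤ t := (by positivity : 0 ≤ 1 / S.lam 0).trans ht
  funext i
  have hz := ae_eq_zero_of_characteristics h.continuousOn_left (c := S.lam) (l := fun _ => 0)
    (r := fun t => min 1 (S.lam 0 * t)) (fun _ => le_rfl) (fun _ => min_le_left _ _)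
    (G := fun i t x => S.rhsA (α t) x i) hM (fun t _ => hA (α t) _ (min_le_left _ _)) ?_
    (fun T hT i f hf => h.left_duhamel hT i hf) ht0 i
  · have h1 : min 1 (S.lam 0 * t) = 1 := min_eq_left (by
      rw [div_le_iff₀ hpos] at ht; linarith)
    simp only [h1] at hz
    exact Lp_eq_zero_of_ae_Ioo hz
  -- Since `λ_i ≥ λ₁`, going back in time from below the line `x = λ₁ t` stays below it.
  · intro i t T x ht hT hx hm
    have := hm.2.trans_le (min_le_right _ _)
    have := S.lam_zero_le i
    exact ⟨hx.1, lt_min hx.2 (by nlinarith)⟩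

/-- Besides the transported bump in `ψ`, the adjoint condition at `x = 1` forces a nonzero `φ`. It
does no harm: after `t₀` it pairs with `α = 0`, and before `t₀` it vanishes, as does `ψ`. -/
lemma IsSolution.right_duhamel (h : S.IsSolution α₀ β₀ α β) {t₀ : ℝ} (ht₀ : 0 ≤ t₀)
    (hα : ∀ t, t₀ ≤ t → α t = 0) {T : ℝ} (hT : 0 ≤ T) (i : Fin m)
    {f : ℝ → ℝ} (hf : IsBump (Ioo (max 0 (1 - S.mu 0 * (T - t₀))) 1) f) :
    ∫ x in (0 : ℝ)..1, f x * β T i x =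
      ∫ t in (0 : ℝ)..T, ∫ x in (0 : ℝ)..1,
        f (x + -S.mu i * (T - t)) * ∑ j, S.Omega x i j * β t j x := by
  have hmu := S.mu_zero_le i
  have hpos := S.mu_pos
  have hlam : ∀ j, S.lam j ≠ 0 := fun j => (S.lam_pos.trans_le (S.lam_zero_le j)).ne'
  -- Because `μ_i ≥ μ₁`, a point followed back to a time before `t₀` would lie beyond `x = 1`; so up
  -- to `t₀` the test functions vanish on `[0, 1]`.
  have hout : ∀ t ≤ t₀, t ≤ T → ∀ x ≤ 1,
      x + -S.mu i * (T - t) ∉ Ioo (max 0 (1 - S.mu 0 * (T - t₀))) 1 := by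
    intro t ht htT x hx hm
    have := (le_max_right _ _).trans_lt hm.1
    nlinarith
  -- `φ` is constant in `x`, with its value solved from the adjoint condition.
  have htest : S.IsTest T (fun t _ j => S.R₁ i j * S.mu i / S.lam j * f (1 + -S.mu i * (T - t)))
      (fun t x j => if j = i then f (x + -S.mu i * (T - t)) else 0) := by
    refine ⟨contDiff_pi.2 fun j => ?_, contDiff_pi.2 fun j => ?_, fun t ht => ?_, fun t ht j => ?_⟩
    · exact contDiff_const.mul (hf.contDiff.comp (by fun_prop))
    · split_ifs
      · exact hf.contDiff.comp (by fun_prop)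
      · exact contDiff_const
    · have : f (0 + -S.mu i * (T - t)) = 0 := hf.eq_zero fun hm => by
        have := (le_max_left _ _).trans_lt hm.1
        nlinarith [ht.2]
      funext j
      simp [-zero_add, -neg_mul, this]
    · have := hlam j
      simp
      field_simp
  have hw := h.weak T hT _ _ htest
  have hinit : ∫ x in (0 : ℝ)..1, f (x + -S.mu i * T) * β₀ i x = 0 := by
    rw [intervalIntegral_eq_setIntegral_of_eq_zero (s := ∅) (empty_subset _) fun x hx _ => by
      have := hout 0 ht₀ hT x hx.2.le
      rw [sub_zero] at this
      rw [hf.eq_zero this, zero_mul]]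
    simp
  have hφ0 : f (1 + -S.mu i * T) = 0 := by
    have := hout 0 ht₀ hT 1 le_rfl
    rw [sub_zero] at this
    exact hf.eq_zero this
  have hpair0 : pairing (fun _ j => S.R₁ i j * S.mu i / S.lam j * f (1 + -S.mu i * (T - 0)))
      (fun x j => if j = i then f (x + -S.mu i * (T - 0)) else 0) α₀ β₀ = 0 := by
    simpa [-neg_mul, pairing, hφ0] using hinit
  have hpairT : pairing (fun _ j => S.R₁ i j * S.mu i / S.lam j * f (1 + -S.mu i * (T - T)))
      (fun x j => if j = i then f (x + -S.mu i * (T - T)) else 0) (α T) (β T) =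
      ∫ x in (0 : ℝ)..1, f x * β T i x := by
    have : f 1 = 0 := hf.eq_zero fun hm => lt_irrefl _ hm.2
    simp [-neg_mul, pairing, this]
  have hd : ∀ t x j, deriv (fun s => if j = i then f (x + -S.mu i * (T - s)) else 0) t -
      S.mu j * deriv (fun y => if j = i then f (y + -S.mu i * (T - t)) else 0) x = 0 := by
    intro t x j
    by_cases hj : j = i
    · subst hj
      have := deriv_add_mul_deriv_comp hf.contDiff (-S.mu j) T t x
      simp only [if_true]
      linarith
    · simp [hj]
  rw [hpair0, hpairT, sub_zero] at hw
  rw [hw]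
  refine intervalIntegral.integral_congr fun t ht => ?_
  rw [uIcc_of_le hT] at ht
  refine intervalIntegral.integral_congr_ae ?_
  simp only [hd]
  rcases le_total t t₀ with htt | htt
  · refine Filter.Eventually.of_forall fun x hx => ?_
    rw [uIoc_of_le zero_le_one] at hx
    -- The time derivative of `φ` also multiplies `α`, which is not known to vanish before `t₀`.
    have hφd : ∀ j, deriv (fun s => S.R₁ i j * S.mu i / S.lam j * f (1 + -S.mu i * (T - s))) t
        = 0 := fun j => by
      have h1 : HasDerivAt (fun s => 1 + -S.mu i * (T - s)) (-S.mu i * -1) t :=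
        (((hasDerivAt_id t).const_sub T).const_mul _).const_add 1
      have h2 := ((hf.hasDerivAt_zero (hout t htt ht.2 1 le_rfl)).comp t h1).const_mul
        (S.R₁ i j * S.mu i / S.lam j)
      simpa [-neg_mul] using h2.deriv
    simp [-neg_mul, hφd, hf.eq_zero (hout t htt ht.2 1 le_rfl), hf.eq_zero (hout t htt ht.2 x hx.2)]
  · rw [hα t htt]
    filter_upwards [ae_coe_zero, S.rhsA_zero, S.rhsB_zero_left (β t)] with x h0 hA hB hx
    rw [uIoc_of_le zero_le_one] at hx
    have hx' := Ioc_subset_Icc_self hx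
    simp only [Pi.zero_apply, h0 hx', hA hx', hB hx']
    simp [-neg_mul]

lemma IsSolution.right_eq_zero (h : S.IsSolution α₀ β₀ α β) {t₀ : ℝ} (ht₀ : 0 ≤ t₀)
    (hα : ∀ t, t₀ ≤ t → α t = 0) {t : ℝ} (ht : 1 / S.mu 0 + t₀ ≤ t) : β t = 0 := by
  obtain ⟨M, hM, hB⟩ := S.exists_abs_Omega_le
  have hpos := S.mu_pos
  have hmul : 1 ≤ S.mu 0 * (t - t₀) := by
    rw [← le_sub_iff_add_le, div_le_iff₀ hpos] at ht
    linarith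
  have ht0 : 0 ≤ t := by
    have : 0 ≤ 1 / S.mu 0 := by positivity
    linarith
  funext i
  -- The sections are empty up to time `t₀`, so `β(t₀)` may be arbitrary; they then grow leftward at
  -- the slowest speed `μ₁`.
  have hz := ae_eq_zero_of_characteristics h.continuousOn_right (c := fun i => -S.mu i)
    (l := fun t => max 0 (1 - S.mu 0 * (t - t₀))) (r := fun _ => 1)
    (fun _ => le_max_left _ _) (fun _ => le_rfl)
    (G := fun i t x => ∑ j, S.Omega x i j * β t j x) hM
    (fun t _ => hB (β t) _ (le_max_left _ _)) ?_
    (fun T hT i f hf => h.right_duhamel ht₀ hα hT i hf) ht0 i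
  · have h1 : max 0 (1 - S.mu 0 * (t - t₀)) = 0 := max_eq_left (by linarith)
    simp only [h1] at hz
    exact Lp_eq_zero_of_ae_Ioo hz
  · intro i t T x ht hT hx hm
    have := (le_max_right _ _).trans_lt hm.1
    have := S.mu_zero_le i
    exact ⟨max_lt hx.1 (by nlinarith), hx.2⟩

end ErrorTargetSystem

theorem lemma5 {n m : ℕ} [NeZero n] [NeZero m] (S : ErrorTargetSystem n m)
    (α₀ : Fin n → L2unit) (β₀ : Fin m → L2unit)
    (α : ℝ → Fin n → L2unit) (β : ℝ → Fin m → L2unit)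
    (h : S.IsSolution α₀ β₀ α β) :
    ∀ t : ℝ, S.tF ≤ t → α t = 0 ∧ β t = 0 := by
  intro t ht
  have hlam : 0 ≤ 1 / S.lam 0 := (one_div_pos.2 S.lam_pos).le
  have hmu : 0 ≤ 1 / S.mu 0 := (one_div_pos.2 S.mu_pos).le
  exact ⟨h.left_eq_zero (by unfold ErrorTargetSystem.tF at ht; linarith),
    h.right_eq_zero hlam (fun t ht => h.left_eq_zero ht) ht⟩
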